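/- Let $1 < r < 2$, $1 \leqslant p < r$, and let $\{X_{n,k},\ 1 \leqslant k \leqslant n,\ n \geqslant 1\}$ be a triangular array of real random variables on a probability space $(\Omega,\mathcal F,\mathbb P)$ with $\mathbb{E}\,\lvert X_{n,k}\rvert^{r} < \infty$ for all $n \geqslant 1$ and $1 \leqslant k \leqslant n$. Suppose the array is row-wise pairwise negatively quadrant dependent (NQD), i.e. for every $n \geqslant 1$, all $1 \leqslant j \neq k \leqslant n$ and all $x,y \in \mathbb{R}$, $$\mathbb{P}\{X_{n,j} \leqslant x,\, X_{n,k} \leqslant y\} \leqslant \mathbb{P}\{X_{n,j} \leqslant x\}\,\mathbb{P}\{X_{n,k} \leqslant y\}.$$ Let $\{b_n\}_{n\geqslant 1}$ be a sequence of positive real numbers such that (1) $\displaystyle\sum_{n=1}^{\infty}\sum_{k=1}^{n} b_n^{-r}\int_0^{b_n^{r}} \mathbb{P}\{\lvert X_{n,k}\rvert^{r} > t\}\,\mathrm{d}t < \infty$, (2) $\displaystyle\sum_{n=1}^{\infty}\sum_{k=1}^{n} \frac{\mathbb{E}\,\lvert X_{n,k}\rvert I_{\{\lvert X_{n,k}\rvert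 > b_n\}}}{b_n} < \infty$, (3) $\displaystyle\sum_{n=1}^{\infty}\sum_{k=1}^{n} b_n^{-p}\int_{b_n^{p}}^{\infty} \mathbb{P}\{\lvert X_{n,k}\rvert^{p} > t\}\,\mathrm{d}t < \infty$, where $I_A$ denotes the indicator of the event $A$. Then, writing $x_+ = \max(x,0)$, $$\sum_{n=1}^{\infty} \mathbb{E}\left[\frac{\left\lvert\sum_{k=1}^{n}(X_{n,k} - \mathbb{E}\,X_{n,k})\right\rvert}{b_n} - \varepsilon\right]_+^{p} < \infty \quad\text{for all } \varepsilon > 0.$$ -/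

import Mathlib

open MeasureTheory
open scoped ENNReal

/-- Two real random variables are negatively quadrant dependent (NQD):
`P (X ≤ x, Y ≤ y) ≤ P (X ≤ x) P (Y ≤ y)` for all real `x`, `y`. -/
def NQD {Ω : Type*} [MeasurableSpace Ω] (μ : Measure Ω) (X Y : Ω → ℝ) : Prop :=
  ∀ x y : ℝ, μ {ω | X ω ≤ x ∧ Y ω ≤ y} ≤ μ {ω | X ω ≤ x} * μ {ω | Y ω ≤ y}

/-- A triangular array, with row `n ≥ 1` consisting of `n` random variables, is row-wise pairwise
NQD if any two variables at different positions of the same row are NQD. -/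
def RowwisePairwiseNQD {Ω : Type*} [MeasurableSpace Ω] (μ : Measure Ω)
    (X : (n : ℕ+) → Fin n → Ω → ℝ) : Prop :=
  ∀ (n : ℕ+) (j k : Fin n), j ≠ k → NQD μ (X n j) (X n k)

/-!
Split each variable at the level `b` of its row as `X = clip b X + softThreshold b X`. Both parts
are monotone functions of `X`, so pairwise NQD survives. By the bivariate layer cake formula, NQD
square integrable variables have nonpositive covariance, so the second moment of the centred sum of
the clipped parts is at most the sum of their second moments, which `(1)` controls.

The `p`-th moment of the centred sum of the excess parts is controlled by `(3)` through a von
Bahr–Esseen inequality for pairwise NQD variables: splitting at an arbitrary level `s`, with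
Chebyshev for the clipped parts and Markov for the excess parts, bounds the tail at `s` of a centred
sum by `∑ 𝔼 4 min (|Z|/s) (|Z|/s)²`, and integrating this against `p s ^ (p - 1) ds` gives a
multiple of `∑ 𝔼 |Z| ^ p` when `1 < p < 2`. The endpoints `p = 1` and `p = 2` are the triangle
inequality and the covariance bound.
-/

section

open ProbabilityTheory Filter Topology
open scoped NNReal

universe u

variable {Ω : Type*} [MeasurableSpace Ω] {μ : Measure Ω}

theorem lintegral_ofReal_eq_lintegral_meas_le {f : Ω → ℝ} (hf : AEMeasurable f μ) :
    ∫⁻ ω, ENNReal.ofReal (f ω) ∂μ = ∫⁻ t in Set.Ioi 0, μ {ω | t ≤ f ω} := by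
  have layercake := lintegral_eq_lintegral_meas_le μ
    (.of_forall fun ω => le_max_right (f ω) 0) (hf.max aemeasurable_const)
  simp only [ENNReal.ofReal_max, ENNReal.ofReal_zero, max_zero] at layercake
  rw [layercake]
  refine setLIntegral_congr_fun measurableSet_Ioi fun t (ht : 0 < t) => ?_
  simp only [le_max_iff, ht.not_ge, or_false]

theorem lintegral_ofReal_eq_lintegral_meas_lt {f : Ω → ℝ} (hf : AEMeasurable f μ) :
    ∫⁻ ω, ENNReal.ofReal (f ω) ∂μ = ∫⁻ t in Set.Ioi 0, μ {ω | t < f ω} := by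
  rw [lintegral_ofReal_eq_lintegral_meas_le hf]
  exact lintegral_congr_ae (meas_le_ae_eq_meas_lt μ _ f)

theorem lintegral_ofReal_mul_ofReal_eq_lintegral_lintegral_meas_le {f g : Ω → ℝ}
    (hf : AEMeasurable f μ) (hg : AEMeasurable g μ) :
    ∫⁻ ω, ENNReal.ofReal (f ω) * ENNReal.ofReal (g ω) ∂μ =
      ∫⁻ s in Set.Ioi 0, ∫⁻ t in Set.Ioi 0, μ {ω | s ≤ f ω ∧ t ≤ g ω} := by
  set ν := μ.withDensity fun ω => ENNReal.ofReal (g ω)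
  have hνμ : ν ≪ μ := withDensity_absolutelyContinuous μ _
  have hf_le (s : ℝ) : NullMeasurableSet {ω | s ≤ f ω} μ :=
    nullMeasurableSet_le aemeasurable_const hf
  calc ∫⁻ ω, ENNReal.ofReal (f ω) * ENNReal.ofReal (g ω) ∂μ
      = ∫⁻ ω, ENNReal.ofReal (f ω) ∂ν := by
        rw [lintegral_withDensity_eq_lintegral_mul₀ hg.ennreal_ofReal hf.ennreal_ofReal]
        simp only [Pi.mul_apply, mul_comm]
    _ = ∫⁻ s in Set.Ioi 0, ν {ω | s ≤ f ω} :=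
        lintegral_ofReal_eq_lintegral_meas_le (hf.mono_ac hνμ)
    _ = ∫⁻ s in Set.Ioi 0, ∫⁻ t in Set.Ioi 0, μ {ω | s ≤ f ω ∧ t ≤ g ω} := by
        refine lintegral_congr fun s => ?_
        rw [withDensity_apply₀ _ (hf_le s), lintegral_ofReal_eq_lintegral_meas_le hg.restrict]
        refine lintegral_congr fun t => ?_
        rw [Measure.restrict_apply₀' (hf_le s), Set.inter_comm, Set.ofPred_and]

theorem setLIntegral_Ioi_meas_lt {W : Ω → ℝ} (hW : AEMeasurable W μ) (M : ℝ) :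
    ∫⁻ t in Set.Ioi M, μ {ω | t < W ω} = ∫⁻ ω, ENNReal.ofReal (W ω - M) ∂μ := by
  rw [lintegral_ofReal_eq_lintegral_meas_lt (hW.sub_const M),
    ← (measurePreserving_add_right volume M).setLIntegral_comp_preimage_emb
      (measurableEmbedding_addRight M)]
  simp only [Set.preimage_add_const_Ioi, sub_self, lt_sub_iff_add_lt]

theorem setLIntegral_Ioc_meas_lt {W : Ω → ℝ} (hW : AEMeasurable W μ) {M : ℝ} (hM : 0 ≤ M) :
    ∫⁻ t in Set.Ioc 0 M, μ {ω | t < W ω} = ∫⁻ ω, ENNReal.ofReal (min (W ω) M) ∂μ := by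
  calc ∫⁻ t in Set.Ioc 0 M, μ {ω | t < W ω}
      = ∫⁻ t in Set.Ioc 0 M, μ {ω | t ≤ W ω} :=
        (lintegral_congr_ae (meas_le_ae_eq_meas_lt μ _ W)).symm
    _ = ∫⁻ t in Set.Ioc 0 M, μ {ω | t ≤ min (W ω) M} :=
        setLIntegral_congr_fun measurableSet_Ioc fun t ht => by
          simp only [le_min_iff, ht.2, and_true]
    _ = ∫⁻ t in Set.Ioi 0, μ {ω | t ≤ min (W ω) M} := by
        have vanish : ∫⁻ t in Set.Ioi M, μ {ω | t ≤ min (W ω) M} = 0 :=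
          setLIntegral_eq_zero measurableSet_Ioi fun t (ht : M < t) => by
            simp [ht.not_ge]
        rw [← Set.Ioc_union_Ioi_eq_Ioi hM,
          lintegral_union measurableSet_Ioi (Set.Ioc_disjoint_Ioi le_rfl), vanish, add_zero]
    _ = ∫⁻ ω, ENNReal.ofReal (min (W ω) M) ∂μ :=
        (lintegral_ofReal_eq_lintegral_meas_le (hW.min aemeasurable_const)).symm

theorem eq_empty_or_univ_or_Iic_of_isLowerSet_of_isClosed {α : Type*}
    [ConditionallyCompleteLinearOrder α] [TopologicalSpace α] [OrderTopology α] {S : Set α}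
    (hS : IsLowerSet S) (hc : IsClosed S) : S = ∅ ∨ S = Set.univ ∨ ∃ a, S = Set.Iic a := by
  rcases S.eq_empty_or_nonempty with h_empty | h_nonempty
  · exact .inl h_empty
  by_cases h_bdd : BddAbove S
  · exact .inr <| .inr ⟨sSup S, Set.Subset.antisymm (fun x hx => le_csSup h_bdd hx)
      fun x hx => hS hx (hc.csSup_mem h_nonempty h_bdd)⟩
  · refine .inr <| .inl <| Set.eq_univ_of_forall fun x => ?_
    obtain ⟨y, hy, hxy⟩ := not_bddAbove_iff.1 h_bdd x
    exact hS hxy.le hy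

namespace NQD

variable {X Y : Ω → ℝ}

theorem lintegral_ofReal_sub_mul_le (h : NQD μ X Y) (hX : AEMeasurable X μ)
    (hY : AEMeasurable Y μ) (M N : ℝ) :
    ∫⁻ ω, ENNReal.ofReal (M - X ω) * ENNReal.ofReal (N - Y ω) ∂μ ≤
      (∫⁻ ω, ENNReal.ofReal (M - X ω) ∂μ) * ∫⁻ ω, ENNReal.ofReal (N - Y ω) ∂μ := by
  have meas_antitone (f : Ω → ℝ) : Measurable fun t => μ {ω | t ≤ f ω} :=
    Antitone.measurable fun s t hst => measure_mono fun ω hω => hst.trans hω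
  rw [lintegral_ofReal_mul_ofReal_eq_lintegral_lintegral_meas_le (hX.const_sub M) (hY.const_sub N),
    lintegral_ofReal_eq_lintegral_meas_le (hX.const_sub M),
    lintegral_ofReal_eq_lintegral_meas_le (hY.const_sub N),
    ← lintegral_mul_const _ (meas_antitone _)]
  refine lintegral_mono fun s => ?_
  rw [← lintegral_const_mul _ (meas_antitone _)]
  refine lintegral_mono fun t => ?_
  simpa only [le_sub_iff_add_le, add_comm] using h (M - s) (N - t)

theorem covariance_min_nonpos [IsProbabilityMeasure μ] (h : NQD μ X Y) (hX : MemLp X 2 μ)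
    (hY : MemLp Y 2 μ) (M : ℝ) : cov[fun ω => min (X ω) M, fun ω => min (Y ω) M; μ] ≤ 0 := by
  have memLp_min {Z : Ω → ℝ} (hZ : MemLp Z 2 μ) : MemLp (fun ω => min (Z ω) M) 2 μ :=
    hZ.inf (memLp_const M)
  set U : Ω → ℝ := fun ω => M - min (X ω) M
  set V : Ω → ℝ := fun ω => M - min (Y ω) M
  have hU : MemLp U 2 μ := (memLp_const M).sub (memLp_min hX)
  have hV : MemLp V 2 μ := (memLp_const M).sub (memLp_min hY)
  have hU0 : 0 ≤ U := fun ω => sub_nonneg.2 (min_le_right _ _)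
  have hV0 : 0 ≤ V := fun ω => sub_nonneg.2 (min_le_right _ _)
  have ofReal_sub_min (x : ℝ) : ENNReal.ofReal (M - min x M) = ENNReal.ofReal (M - x) := by
    rcases le_total x M with hx | hx <;> simp [hx]
  have integral_mul_le : ∫ ω, (U * V) ω ∂μ ≤ (∫ ω, U ω ∂μ) * ∫ ω, V ω ∂μ := by
    rw [← ENNReal.ofReal_le_ofReal_iff (mul_nonneg (integral_nonneg hU0) (integral_nonneg hV0)),
      ENNReal.ofReal_mul (integral_nonneg hU0),
      ofReal_integral_eq_lintegral_ofReal (hU.integrable_mul hV)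
        (.of_forall (mul_nonneg hU0 hV0)),
      ofReal_integral_eq_lintegral_ofReal (hU.integrable one_le_two) (.of_forall hU0),
      ofReal_integral_eq_lintegral_ofReal (hV.integrable one_le_two) (.of_forall hV0)]
    simpa only [Pi.mul_apply, ENNReal.ofReal_mul (hU0 _), U, V, ofReal_sub_min] using
      h.lintegral_ofReal_sub_mul_le hX.aemeasurable hY.aemeasurable M M
  calc cov[fun ω => min (X ω) M, fun ω => min (Y ω) M; μ] = cov[U, V; μ] := by
        rw [covariance_const_sub_left ((memLp_min hX).integrable one_le_two),
          covariance_const_sub_right ((memLp_min hY).integrable one_le_two), neg_neg]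
    _ = ∫ ω, (U * V) ω ∂μ - (∫ ω, U ω ∂μ) * ∫ ω, V ω ∂μ := covariance_eq_sub hU hV
    _ ≤ 0 := sub_nonpos.2 integral_mul_le

theorem covariance_nonpos [IsProbabilityMeasure μ] (h : NQD μ X Y) (hX : MemLp X 2 μ)
    (hY : MemLp Y 2 μ) : cov[X, Y; μ] ≤ 0 := by
  have memLp_min {Z : Ω → ℝ} (hZ : MemLp Z 2 μ) (M : ℕ) : MemLp (fun ω => min (Z ω) M) 2 μ :=
    hZ.inf (memLp_const (M : ℝ))
  have abs_min_le (x : ℝ) (M : ℕ) : |min x M| ≤ |x| := by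
    have : (0 : ℝ) ≤ M := M.cast_nonneg
    grind
  have tendsto_min (x : ℝ) : Tendsto (fun M : ℕ => min x M) atTop (𝓝 x) :=
    tendsto_const_nhds.congr' ((eventually_ge_atTop ⌈x⌉₊).mono fun M hM =>
      (min_eq_left (Nat.ceil_le.1 hM)).symm)
  have tendsto_integral {Z : Ω → ℝ} (hZ : MemLp Z 2 μ) :
      Tendsto (fun M : ℕ => ∫ ω, min (Z ω) M ∂μ) atTop (𝓝 (∫ ω, Z ω ∂μ)) :=
    tendsto_integral_of_dominated_convergence (fun ω => |Z ω|)
      (fun M => (memLp_min hZ M).aestronglyMeasurable) (hZ.integrable one_le_two).abs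
      (fun M => .of_forall fun ω => abs_min_le _ M) (.of_forall fun ω => tendsto_min _)
  have tendsto_integral_mul :
      Tendsto (fun M : ℕ => ∫ ω, min (X ω) M * min (Y ω) M ∂μ) atTop (𝓝 (∫ ω, X ω * Y ω ∂μ)) :=
    tendsto_integral_of_dominated_convergence (fun ω => |X ω * Y ω|)
      (fun M => ((memLp_min hX M).integrable_mul (memLp_min hY M)).aestronglyMeasurable)
      (hX.integrable_mul hY).abs
      (fun M => .of_forall fun ω => by
        rw [Real.norm_eq_abs, abs_mul, abs_mul]
        exact mul_le_mul (abs_min_le _ M) (abs_min_le _ M) (abs_nonneg _) (abs_nonneg _))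
      (.of_forall fun ω => (tendsto_min _).mul (tendsto_min _))
  rw [covariance_eq_sub hX hY]
  refine le_of_tendsto (tendsto_integral_mul.sub ((tendsto_integral hX).mul (tendsto_integral hY)))
    (.of_forall fun M => ?_)
  have := h.covariance_min_nonpos hX hY M
  rwa [covariance_eq_sub (memLp_min hX M) (memLp_min hY M)] at this

theorem measure_mem_and_mem_le [IsProbabilityMeasure μ] (h : NQD μ X Y) {S T : Set ℝ}
    (hS : IsLowerSet S) (hSc : IsClosed S) (hT : IsLowerSet T) (hTc : IsClosed T) :
    μ {ω | X ω ∈ S ∧ Y ω ∈ T} ≤ μ {ω | X ω ∈ S} * μ {ω | Y ω ∈ T} := by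
  rcases eq_empty_or_univ_or_Iic_of_isLowerSet_of_isClosed hS hSc with rfl | rfl | ⟨x, rfl⟩ <;>
    rcases eq_empty_or_univ_or_Iic_of_isLowerSet_of_isClosed hT hTc with rfl | rfl | ⟨y, rfl⟩
  case inr.inr.inr.inr => exact h x y
  all_goals simp

theorem comp_monotone [IsProbabilityMeasure μ] (h : NQD μ X Y) {f g : ℝ → ℝ}
    (hf : Monotone f) (hfc : Continuous f) (hg : Monotone g) (hgc : Continuous g) :
    NQD μ (fun ω => f (X ω)) (fun ω => g (Y ω)) := fun x y =>
  h.measure_mem_and_mem_le ((isLowerSet_Iic x).preimage hf) (isClosed_Iic.preimage hfc)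
    ((isLowerSet_Iic y).preimage hg) (isClosed_Iic.preimage hgc)

end NQD

theorem variance_sum_le_sum_variance_of_NQD [IsProbabilityMeasure μ] {κ : Type*} [Fintype κ]
    {Z : κ → Ω → ℝ} (hZ : ∀ k, MemLp (Z k) 2 μ) (h : Pairwise fun j k => NQD μ (Z j) (Z k)) :
    Var[∑ k, Z k; μ] ≤ ∑ k, Var[Z k; μ] := by
  classical
  rw [variance_sum hZ]
  refine Finset.sum_le_sum fun j _ => ?_
  rw [← Finset.add_sum_erase _ _ (Finset.mem_univ j), covariance_self (hZ j).aemeasurable]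
  exact add_le_of_nonpos_right <| Finset.sum_nonpos fun k hk =>
    (h (Finset.ne_of_mem_erase hk).symm).covariance_nonpos (hZ j) (hZ k)

/-- The centred sum `∑ k, (Z k - 𝔼 Z k)` of a finite family of real random variables. -/
noncomputable def centeredSum (μ : Measure Ω) {κ : Type*} [Fintype κ] (Z : κ → Ω → ℝ) (ω : Ω) : ℝ :=
  ∑ k, (Z k ω - ∫ ω', Z k ω' ∂μ)

section CenteredSum

variable {κ : Type*} [Fintype κ] {Z W : κ → Ω → ℝ}

theorem aemeasurable_centeredSum (hZ : ∀ k, AEMeasurable (Z k) μ) :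
    AEMeasurable (centeredSum μ Z) μ :=
  Finset.aemeasurable_fun_sum _ fun k _ => (hZ k).sub_const _

theorem centeredSum_add (hZ : ∀ k, Integrable (Z k) μ) (hW : ∀ k, Integrable (W k) μ) :
    centeredSum μ (Z + W) = centeredSum μ Z + centeredSum μ W := by
  ext ω
  simp only [centeredSum, Pi.add_apply, ← Finset.sum_add_distrib, integral_add (hZ _) (hW _)]
  exact Finset.sum_congr rfl fun k _ => by ring

theorem lintegral_abs_centeredSum_le [IsProbabilityMeasure μ] (hZ : ∀ k, AEMeasurable (Z k) μ) :
    ∫⁻ ω, ENNReal.ofReal |centeredSum μ Z ω| ∂μ ≤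
      2 * ∑ k, ∫⁻ ω, ENNReal.ofReal |Z k ω| ∂μ := by
  simp_rw [← Real.enorm_eq_ofReal_abs]
  calc ∫⁻ ω, ‖centeredSum μ Z ω‖ₑ ∂μ
      ≤ ∫⁻ ω, ∑ k, (‖Z k ω‖ₑ + ‖∫ ω', Z k ω' ∂μ‖ₑ) ∂μ :=
        lintegral_mono fun ω => (enorm_sum_le _ _).trans
          (Finset.sum_le_sum fun k _ => enorm_sub_le)
    _ = ∑ k, (∫⁻ ω, ‖Z k ω‖ₑ ∂μ + ‖∫ ω', Z k ω' ∂μ‖ₑ) := by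
        rw [lintegral_finsetSum' _ fun k _ => (hZ k).enorm.add_const _]
        simp only [lintegral_add_right' _ aemeasurable_const, lintegral_const, measure_univ,
          mul_one]
    _ ≤ ∑ k, (∫⁻ ω, ‖Z k ω‖ₑ ∂μ + ∫⁻ ω, ‖Z k ω‖ₑ ∂μ) := by
        gcongr
        exact enorm_integral_le_lintegral_enorm _
    _ = 2 * ∑ k, ∫⁻ ω, ‖Z k ω‖ₑ ∂μ := by simp only [← two_mul, Finset.mul_sum]

theorem lintegral_sq_centeredSum_eq_variance [IsFiniteMeasure μ] (hZ : ∀ k, MemLp (Z k) 2 μ) :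
    ∫⁻ ω, ENNReal.ofReal (centeredSum μ Z ω ^ 2) ∂μ = ENNReal.ofReal Var[∑ k, Z k; μ] := by
  rw [ofReal_variance (memLp_finsetSum' _ fun k _ => hZ k), evariance_eq_lintegral_ofReal]
  simp only [centeredSum, Finset.sum_apply, Finset.sum_sub_distrib,
    integral_finsetSum _ fun k _ => (hZ k).integrable one_le_two]

theorem lintegral_sq_centeredSum_le [IsProbabilityMeasure μ]
    (hZ : ∀ k, AEStronglyMeasurable (Z k) μ) (h : Pairwise fun j k => NQD μ (Z j) (Z k)) :
    ∫⁻ ω, ENNReal.ofReal (centeredSum μ Z ω ^ 2) ∂μ ≤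
      ∑ k, ∫⁻ ω, ENNReal.ofReal (Z k ω ^ 2) ∂μ := by
  by_cases hL2 : ∀ k, MemLp (Z k) 2 μ
  · calc ∫⁻ ω, ENNReal.ofReal (centeredSum μ Z ω ^ 2) ∂μ
        = ENNReal.ofReal Var[∑ k, Z k; μ] := lintegral_sq_centeredSum_eq_variance hL2
      _ ≤ ENNReal.ofReal (∑ k, Var[Z k; μ]) :=
          ENNReal.ofReal_le_ofReal (variance_sum_le_sum_variance_of_NQD hL2 h)
      _ = ∑ k, ENNReal.ofReal Var[Z k; μ] :=
          ENNReal.ofReal_sum_of_nonneg fun k _ => variance_nonneg _ _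
      _ ≤ ∑ k, ∫⁻ ω, ENNReal.ofReal (Z k ω ^ 2) ∂μ := by
          gcongr with k
          rw [← ofReal_integral_eq_lintegral_ofReal (hL2 k).integrable_sq
            (.of_forall fun ω => sq_nonneg _)]
          exact ENNReal.ofReal_le_ofReal (variance_le_expectation_sq (hZ k))
  · obtain ⟨k, hk⟩ := not_forall.1 hL2
    have infinite : ∫⁻ ω, ENNReal.ofReal (Z k ω ^ 2) ∂μ = ∞ := by
      by_contra hne
      refine hk ((memLp_two_iff_integrable_sq (hZ k)).2 ⟨(hZ k).pow 2, ?_⟩)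
      rw [hasFiniteIntegral_iff_ofReal (.of_forall fun ω => sq_nonneg _)]
      exact lt_top_iff_ne_top.2 hne
    rw [ENNReal.sum_eq_top.2 ⟨k, Finset.mem_univ k, infinite⟩]
    exact le_top

end CenteredSum

/-- Truncation of a real number to the interval `[-s, s]`. -/
def clip (s x : ℝ) : ℝ := max (-s) (min x s)

/-- Soft thresholding at level `s`: the part of a real number that truncation to `[-s, s]` cuts
off. -/
def softThreshold (s x : ℝ) : ℝ := x - clip s x

theorem clip_add_softThreshold (s x : ℝ) : clip s x + softThreshold s x = x :=
  add_sub_cancel _ _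

theorem monotone_clip (s : ℝ) : Monotone (clip s) := fun _ _ h =>
  max_le_max le_rfl (min_le_min h le_rfl)

@[fun_prop]
theorem continuous_clip (s : ℝ) : Continuous (clip s) := by
  unfold clip
  fun_prop

theorem monotone_softThreshold (s : ℝ) : Monotone (softThreshold s) := by
  intro x y h
  simp only [softThreshold, clip]
  grind

@[fun_prop]
theorem continuous_softThreshold (s : ℝ) : Continuous (softThreshold s) :=
  continuous_id.sub (continuous_clip s)

theorem abs_clip {s : ℝ} (hs : 0 ≤ s) (x : ℝ) : |clip s x| = min |x| s := by
  simp only [clip]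
  grind

theorem abs_softThreshold {s : ℝ} (hs : 0 ≤ s) (x : ℝ) :
    |softThreshold s x| = max (|x| - s) 0 := by
  simp only [softThreshold, clip]
  grind

theorem setLIntegral_Ioc_rpow {a : ℝ} (ha : -1 < a) {z : ℝ} (hz : 0 ≤ z) :
    ∫⁻ s in Set.Ioc 0 z, ENNReal.ofReal (s ^ a) = ENNReal.ofReal (z ^ (a + 1) / (a + 1)) := by
  rw [← ofReal_integral_eq_lintegral_ofReal
      ((intervalIntegrable_iff_integrableOn_Ioc_of_le hz).1
        (intervalIntegral.intervalIntegrable_rpow' ha))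
      ((ae_restrict_mem measurableSet_Ioc).mono fun s hs => Real.rpow_nonneg hs.1.le a),
    ← intervalIntegral.integral_of_le hz, integral_rpow (.inl ha),
    Real.zero_rpow (by linarith), sub_zero]

theorem setLIntegral_Ioi_rpow {a : ℝ} (ha : a < -1) {z : ℝ} (hz : 0 < z) :
    ∫⁻ s in Set.Ioi z, ENNReal.ofReal (s ^ a) = ENNReal.ofReal (-z ^ (a + 1) / (a + 1)) := by
  rw [← ofReal_integral_eq_lintegral_ofReal (integrableOn_Ioi_rpow_of_lt ha hz)
      ((ae_restrict_mem measurableSet_Ioi).mono fun s hs =>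
        Real.rpow_nonneg (hz.trans hs).le a),
    integral_Ioi_rpow_of_lt ha hz]

theorem setLIntegral_Ioc_min_div_mul_rpow {q : ℝ} (hq : 1 < q) {z : ℝ} (hz : 0 < z) :
    ∫⁻ s in Set.Ioc 0 z, ENNReal.ofReal (min (z / s) ((z / s) ^ 2)) *
      ENNReal.ofReal (s ^ (q - 1)) = ENNReal.ofReal (1 / (q - 1) * z ^ q) := by
  calc _ = ∫⁻ s in Set.Ioc 0 z, ENNReal.ofReal z * ENNReal.ofReal (s ^ (q - 2)) := by
        refine setLIntegral_congr_fun measurableSet_Ioc fun s ⟨hs, hsz⟩ => ?_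
        rw [min_eq_left (le_self_pow₀ ((one_le_div hs).2 hsz) two_ne_zero),
          ← ENNReal.ofReal_mul (by positivity), ← ENNReal.ofReal_mul (by positivity),
          show q - 1 = q - 2 + 1 by ring, Real.rpow_add_one hs.ne']
        field_simp
    _ = ENNReal.ofReal (1 / (q - 1) * z ^ q) := by
        rw [lintegral_const_mul' _ _ ENNReal.ofReal_ne_top,
          setLIntegral_Ioc_rpow (by linarith) hz.le, ← ENNReal.ofReal_mul hz.le,
          show q - 2 + 1 = q - 1 by ring, Real.rpow_sub_one hz.ne']
        field_simp

theorem setLIntegral_Ioi_min_div_mul_rpow {q : ℝ} (hq : q < 2) {z : ℝ} (hz : 0 < z) :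
    ∫⁻ s in Set.Ioi z, ENNReal.ofReal (min (z / s) ((z / s) ^ 2)) *
      ENNReal.ofReal (s ^ (q - 1)) = ENNReal.ofReal (1 / (2 - q) * z ^ q) := by
  calc _ = ∫⁻ s in Set.Ioi z, ENNReal.ofReal (z ^ 2) * ENNReal.ofReal (s ^ (q - 3)) := by
        refine setLIntegral_congr_fun measurableSet_Ioi fun s (hzs : z < s) => ?_
        have hs : 0 < s := hz.trans hzs
        rw [min_eq_right (pow_le_of_le_one (by positivity) ((div_le_one hs).2 hzs.le)
            two_ne_zero), ← ENNReal.ofReal_mul (by positivity),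
          ← ENNReal.ofReal_mul (by positivity),
          show q - 1 = q - 3 + 2 by ring, Real.rpow_add hs, Real.rpow_two]
        field_simp
    _ = ENNReal.ofReal (1 / (2 - q) * z ^ q) := by
        rw [lintegral_const_mul' _ _ ENNReal.ofReal_ne_top,
          setLIntegral_Ioi_rpow (by linarith) hz, ← ENNReal.ofReal_mul (by positivity),
          show q - 3 + 1 = q - 2 by ring, Real.rpow_sub hz, Real.rpow_two, neg_div, ← div_neg,
          neg_sub]
        field_simp

theorem lintegral_min_div_mul_rpow {q : ℝ} (hq1 : 1 < q) (hq2 : q < 2) {z : ℝ} (hz : 0 ≤ z) :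
    ∫⁻ s in Set.Ioi 0, ENNReal.ofReal (min (z / s) ((z / s) ^ 2)) * ENNReal.ofReal (s ^ (q - 1)) =
      ENNReal.ofReal (1 / (q - 1) + 1 / (2 - q)) * ENNReal.ofReal (z ^ q) := by
  rcases hz.eq_or_lt with rfl | hz
  · simp [Real.zero_rpow (by linarith : q ≠ 0)]
  have := sub_pos.2 hq1
  have := sub_pos.2 hq2
  rw [← Set.Ioc_union_Ioi_eq_Ioi hz.le,
    lintegral_union measurableSet_Ioi (Set.Ioc_disjoint_Ioi le_rfl),
    setLIntegral_Ioc_min_div_mul_rpow hq1 hz, setLIntegral_Ioi_min_div_mul_rpow hq2 hz,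
    ← ENNReal.ofReal_add (by positivity) (by positivity), ← ENNReal.ofReal_mul (by positivity),
    add_mul]

section Truncation

variable {κ : Type*} [Fintype κ] {Z : κ → Ω → ℝ}

theorem integrable_clip [IsFiniteMeasure μ] {X : Ω → ℝ} (hX : AEStronglyMeasurable X μ) (s : ℝ) :
    Integrable (fun ω => clip s (X ω)) μ :=
  Integrable.of_bound ((continuous_clip s).comp_aestronglyMeasurable hX) |s| <|
    .of_forall fun ω => by
      simp only [clip, Real.norm_eq_abs]
      grind

theorem integrable_softThreshold [IsFiniteMeasure μ] {X : Ω → ℝ} (hX : Integrable X μ) (s : ℝ) :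
    Integrable (fun ω => softThreshold s (X ω)) μ :=
  hX.sub (integrable_clip hX.aestronglyMeasurable s)

theorem centeredSum_eq_clip_add_softThreshold [IsFiniteMeasure μ] (hZ : ∀ k, Integrable (Z k) μ)
    (s : ℝ) :
    centeredSum μ Z = centeredSum μ (fun k ω => clip s (Z k ω)) +
      centeredSum μ (fun k ω => softThreshold s (Z k ω)) := by
  rw [← centeredSum_add (fun k => integrable_clip (hZ k).aestronglyMeasurable s)
    fun k => integrable_softThreshold (hZ k) s]
  congr 1 with k ω
  exact (clip_add_softThreshold s (Z k ω)).symm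

theorem lintegral_sq_centeredSum_clip_le [IsProbabilityMeasure μ]
    (hZ : ∀ k, AEStronglyMeasurable (Z k) μ) (h : Pairwise fun j k => NQD μ (Z j) (Z k)) (s : ℝ) :
    ∫⁻ ω, ENNReal.ofReal (centeredSum μ (fun k ω' => clip s (Z k ω')) ω ^ 2) ∂μ ≤
      ∑ k, ∫⁻ ω, ENNReal.ofReal (clip s (Z k ω) ^ 2) ∂μ :=
  lintegral_sq_centeredSum_le
    (fun k => (continuous_clip s).comp_aestronglyMeasurable (hZ k))
    fun _ _ hjk => (h hjk).comp_monotone (monotone_clip s) (continuous_clip s)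
      (monotone_clip s) (continuous_clip s)

theorem four_mul_sq_clip_add_abs_softThreshold {s : ℝ} (hs : 0 < s) (x : ℝ) :
    4 / s ^ 2 * clip s x ^ 2 + 4 / s * |softThreshold s x| =
      4 * min (|x| / s) ((|x| / s) ^ 2) := by
  rw [← sq_abs (clip s x), abs_clip hs.le, abs_softThreshold hs.le]
  rcases le_total |x| s with hx | hx
  · rw [min_eq_left hx, max_eq_right (sub_nonpos.2 hx),
      min_eq_right (pow_le_of_le_one (by positivity) ((div_le_one hs).2 hx) two_ne_zero)]
    ring
  · rw [min_eq_right hx, max_eq_left (sub_nonneg.2 hx),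
      min_eq_left (le_self_pow₀ ((one_le_div hs).2 hx) two_ne_zero)]
    field_simp
    ring

theorem one_le_of_lt_abs_add {s a c : ℝ} (hs : 0 < s) (h : s < |a + c|) :
    1 ≤ 4 / s ^ 2 * a ^ 2 + 2 / s * |c| := by
  have h_abs : s < |a| + |c| := h.trans_le (abs_add_le a c)
  rcases le_or_gt (s / 2) |a| with ha | ha
  · have sq_le_four_mul_sq : s ^ 2 ≤ 4 * a ^ 2 := by
      rw [← sq_abs a]
      nlinarith
    calc 1 ≤ 4 / s ^ 2 * a ^ 2 := by
          rw [div_mul_eq_mul_div]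
          exact (one_le_div (by positivity)).2 sq_le_four_mul_sq
      _ ≤ 4 / s ^ 2 * a ^ 2 + 2 / s * |c| := le_add_of_nonneg_right (by positivity)
  · calc 1 ≤ 2 / s * |c| := by
          rw [div_mul_eq_mul_div]
          exact (one_le_div hs).2 (by linarith)
      _ ≤ 4 / s ^ 2 * a ^ 2 + 2 / s * |c| := le_add_of_nonneg_left (by positivity)

theorem meas_lt_abs_add_le {A B : Ω → ℝ} (hA : AEMeasurable A μ) (hB : AEMeasurable B μ) {s : ℝ}
    (hs : 0 < s) :
    μ {ω | s < |A ω + B ω|} ≤ ENNReal.ofReal (4 / s ^ 2) * ∫⁻ ω, ENNReal.ofReal (A ω ^ 2) ∂μ +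
      ENNReal.ofReal (2 / s) * ∫⁻ ω, ENNReal.ofReal |B ω| ∂μ := by
  rw [← lintegral_const_mul' _ _ ENNReal.ofReal_ne_top,
    ← lintegral_const_mul' _ _ ENNReal.ofReal_ne_top, ← lintegral_add_left' (by fun_prop)]
  refine meas_le_lintegral₀ (by fun_prop) fun ω hω => ?_
  rw [← ENNReal.ofReal_mul (by positivity), ← ENNReal.ofReal_mul (by positivity),
    ← ENNReal.ofReal_add (by positivity) (by positivity)]
  exact ENNReal.one_le_ofReal.2 (one_le_of_lt_abs_add hs hω)

theorem meas_lt_abs_centeredSum_le [IsProbabilityMeasure μ] (hZ : ∀ k, Integrable (Z k) μ)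
    (h : Pairwise fun j k => NQD μ (Z j) (Z k)) {s : ℝ} (hs : 0 < s) :
    μ {ω | s < |centeredSum μ Z ω|} ≤
      ∑ k, ∫⁻ ω, ENNReal.ofReal (4 * min (|Z k ω| / s) ((|Z k ω| / s) ^ 2)) ∂μ := by
  have hclip (k : κ) : AEMeasurable (fun ω => clip s (Z k ω)) μ :=
    (integrable_clip (hZ k).aestronglyMeasurable s).aemeasurable
  have hsoft (k : κ) : AEMeasurable (fun ω => softThreshold s (Z k ω)) μ :=
    (integrable_softThreshold (hZ k) s).aemeasurable
  have two_div_mul_two : ENNReal.ofReal (2 / s) * 2 = ENNReal.ofReal (4 / s) := by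
    rw [← ENNReal.ofReal_ofNat 2, ← ENNReal.ofReal_mul (by positivity)]
    ring_nf
  simp only [centeredSum_eq_clip_add_softThreshold hZ s, Pi.add_apply]
  grw [meas_lt_abs_add_le (aemeasurable_centeredSum hclip) (aemeasurable_centeredSum hsoft) hs,
    lintegral_sq_centeredSum_clip_le (fun k => (hZ k).aestronglyMeasurable) h s,
    lintegral_abs_centeredSum_le hsoft]
  rw [← mul_assoc, two_div_mul_two, Finset.mul_sum, Finset.mul_sum, ← Finset.sum_add_distrib]
  refine Finset.sum_le_sum fun k _ => le_of_eq ?_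
  rw [← lintegral_const_mul' _ _ ENNReal.ofReal_ne_top,
    ← lintegral_const_mul' _ _ ENNReal.ofReal_ne_top, ← lintegral_add_left' (by fun_prop)]
  refine lintegral_congr fun ω => ?_
  rw [← four_mul_sq_clip_add_abs_softThreshold hs, ENNReal.ofReal_add (by positivity)
    (by positivity), ENNReal.ofReal_mul (by positivity), ENNReal.ofReal_mul (by positivity)]

theorem lintegral_abs_centeredSum_rpow_le [IsProbabilityMeasure μ] {q : ℝ} (hq1 : 1 < q)
    (hq2 : q < 2) (hZ : ∀ k, Integrable (Z k) μ) (h : Pairwise fun j k => NQD μ (Z j) (Z k)) :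
    ∫⁻ ω, ENNReal.ofReal (|centeredSum μ Z ω| ^ q) ∂μ ≤
      ENNReal.ofReal q * (4 * ENNReal.ofReal (1 / (q - 1) + 1 / (2 - q))) *
        ∑ k, ∫⁻ ω, ENNReal.ofReal (|Z k ω| ^ q) ∂μ := by
  let w (s z : ℝ) : ℝ≥0∞ :=
    ENNReal.ofReal (min (z / s) ((z / s) ^ 2)) * ENNReal.ofReal (s ^ (q - 1))
  have aemeasurable_w (k : κ) : AEMeasurable (fun x : ℝ × Ω => w x.1 |Z k x.2|)
      ((volume.restrict (Set.Ioi 0)).prod μ) := by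
    have := (hZ k).aemeasurable.comp_snd (μ := volume.restrict (Set.Ioi (0 : ℝ)))
    fun_prop
  have tail_le (s : ℝ) (hs : 0 < s) :
      μ {ω | s < |centeredSum μ Z ω|} * ENNReal.ofReal (s ^ (q - 1)) ≤
        4 * ∑ k, ∫⁻ ω, w s |Z k ω| ∂μ := by
    grw [meas_lt_abs_centeredSum_le hZ h hs]
    simp only [w, ENNReal.ofReal_mul zero_le_four, ENNReal.ofReal_ofNat,
      lintegral_mul_const' _ _ ENNReal.ofReal_ne_top,
      lintegral_const_mul' _ _ ENNReal.ofNat_ne_top, ← Finset.sum_mul, ← Finset.mul_sum, mul_assoc,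
      le_refl]
  rw [lintegral_rpow_eq_lintegral_meas_lt_mul μ (.of_forall fun ω => abs_nonneg _)
    (aemeasurable_centeredSum fun k => (hZ k).aemeasurable).abs (zero_lt_one.trans hq1), mul_assoc]
  gcongr
  calc ∫⁻ s in Set.Ioi 0, μ {ω | s < |centeredSum μ Z ω|} * ENNReal.ofReal (s ^ (q - 1))
      ≤ ∫⁻ s in Set.Ioi 0, 4 * ∑ k, ∫⁻ ω, w s |Z k ω| ∂μ :=
        setLIntegral_mono' measurableSet_Ioi tail_le
    _ = 4 * ∑ k, ∫⁻ ω, (∫⁻ s in Set.Ioi 0, w s |Z k ω|) ∂μ := by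
        rw [lintegral_const_mul' _ _ ENNReal.ofNat_ne_top,
          lintegral_finsetSum' _ fun k _ => (aemeasurable_w k).lintegral_prod_right']
        simp only [fun k => lintegral_lintegral_swap (f := fun s ω => w s |Z k ω|)
          (aemeasurable_w k)]
    _ = 4 * ENNReal.ofReal (1 / (q - 1) + 1 / (2 - q)) *
          ∑ k, ∫⁻ ω, ENNReal.ofReal (|Z k ω| ^ q) ∂μ := by
        simp only [w, lintegral_min_div_mul_rpow hq1 hq2 (abs_nonneg _), mul_assoc,
          lintegral_const_mul' _ _ ENNReal.ofReal_ne_top, ← Finset.mul_sum]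

end Truncation

theorem exists_lintegral_abs_centeredSum_rpow_le (μ : Measure Ω) [IsProbabilityMeasure μ] {p : ℝ}
    (hp1 : 1 ≤ p) (hp2 : p ≤ 2) :
    ∃ C : ℝ≥0, ∀ {κ : Type u} [Fintype κ] {Z : κ → Ω → ℝ}, (∀ k, Integrable (Z k) μ) →
      Pairwise (fun j k => NQD μ (Z j) (Z k)) →
      ∫⁻ ω, ENNReal.ofReal (|centeredSum μ Z ω| ^ p) ∂μ ≤
        C * ∑ k, ∫⁻ ω, ENNReal.ofReal (|Z k ω| ^ p) ∂μ := by
  rcases hp1.eq_or_lt with rfl | hp1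
  · refine ⟨2, fun hZ _ => ?_⟩
    simpa only [Real.rpow_one, ENNReal.coe_ofNat] using
      lintegral_abs_centeredSum_le fun k => (hZ k).aemeasurable
  rcases hp2.eq_or_lt with rfl | hp2
  · refine ⟨1, fun hZ h => ?_⟩
    simpa only [Real.rpow_two, sq_abs, ENNReal.coe_one, one_mul] using
      lintegral_sq_centeredSum_le (fun k => (hZ k).aestronglyMeasurable) h
  · exact ⟨p.toNNReal * (4 * (1 / (p - 1) + 1 / (2 - p)).toNNReal), fun hZ h =>
      lintegral_abs_centeredSum_rpow_le hp1 hp2 hZ h⟩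

theorem max_abs_add_sub_rpow_le {ε p : ℝ} (hε : 0 < ε) (hp0 : 0 ≤ p) (hp2 : p ≤ 2) (a c : ℝ) :
    max (|a + c| - ε) 0 ^ p ≤ 2 ^ p * (ε / 2) ^ (p - 2) * a ^ 2 + 2 ^ p * |c| ^ p := by
  have h_abs : |a + c| ≤ |a| + |c| := abs_add_le a c
  rcases le_or_gt (|a| - ε / 2) |c| with hac | hac
  · calc max (|a + c| - ε) 0 ^ p ≤ (2 * |c|) ^ p :=
          Real.rpow_le_rpow (le_max_right _ _) (max_le (by linarith) (by positivity)) hp0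
      _ = 2 ^ p * |c| ^ p := Real.mul_rpow zero_le_two (abs_nonneg c)
      _ ≤ _ := le_add_of_nonneg_left (by positivity)
  · have ha : ε / 2 < |a| := by linarith [abs_nonneg c]
    calc max (|a + c| - ε) 0 ^ p ≤ (2 * |a|) ^ p :=
          Real.rpow_le_rpow (le_max_right _ _) (max_le (by linarith) (by positivity)) hp0
      _ = 2 ^ p * |a| ^ (p - 2) * a ^ 2 := by
          rw [Real.mul_rpow zero_le_two (abs_nonneg a), ← sq_abs a, ← Real.rpow_two, mul_assoc,
            ← Real.rpow_add ((half_pos hε).trans ha), sub_add_cancel]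
      _ ≤ 2 ^ p * (ε / 2) ^ (p - 2) * a ^ 2 := by
          gcongr 2 ^ p * ?_ * a ^ 2
          exact Real.rpow_le_rpow_of_nonpos (half_pos hε) ha.le (by linarith)
      _ ≤ _ := le_add_of_nonneg_right (by positivity)

theorem lintegral_max_abs_add_div_sub_rpow_le {A B : Ω → ℝ} (hA : AEMeasurable A μ) {b ε p : ℝ}
    (hb : 0 < b) (hε : 0 < ε) (hp0 : 0 ≤ p) (hp2 : p ≤ 2) :
    ∫⁻ ω, ENNReal.ofReal (max (|A ω + B ω| / b - ε) 0 ^ p) ∂μ ≤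
      ENNReal.ofReal (2 ^ p * (ε / 2) ^ (p - 2)) *
          (ENNReal.ofReal (b ^ (-2 : ℝ)) * ∫⁻ ω, ENNReal.ofReal (A ω ^ 2) ∂μ) +
        ENNReal.ofReal (2 ^ p) *
          (ENNReal.ofReal (b ^ (-p)) * ∫⁻ ω, ENNReal.ofReal (|B ω| ^ p) ∂μ) := by
  simp only [← lintegral_const_mul' _ _ ENNReal.ofReal_ne_top]
  rw [← lintegral_add_left' (by fun_prop)]
  refine lintegral_mono fun ω => ?_
  have scaling (c : ℝ) : b ^ (-p) * |c| ^ p = |c / b| ^ p := by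
    rw [abs_div, abs_of_pos hb, Real.div_rpow (abs_nonneg c) hb.le, Real.rpow_neg hb.le]
    ring
  have scaling_sq (a : ℝ) : b ^ (-2 : ℝ) * a ^ 2 = (a / b) ^ 2 := by
    rw [div_pow, Real.rpow_neg hb.le, Real.rpow_two]
    ring
  simp only [← ENNReal.ofReal_mul (Real.rpow_nonneg hb.le _), scaling, scaling_sq]
  rw [← ENNReal.ofReal_mul (by positivity), ← ENNReal.ofReal_mul (by positivity),
    ← ENNReal.ofReal_add (by positivity) (by positivity)]
  refine ENNReal.ofReal_le_ofReal ?_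
  rw [← abs_of_pos hb, ← abs_div, abs_of_pos hb, add_div]
  exact max_abs_add_sub_rpow_le hε hp0 hp2 (A ω / b) (B ω / b)

theorem rpow_mul_lintegral_sq_clip_le {X : Ω → ℝ} (hX : AEMeasurable X μ) {b r : ℝ} (hb : 0 < b)
    (hr0 : 0 < r) (hr2 : r ≤ 2) :
    ENNReal.ofReal (b ^ (-2 : ℝ)) * ∫⁻ ω, ENNReal.ofReal (clip b (X ω) ^ 2) ∂μ ≤
      ENNReal.ofReal (b ^ (-r)) * ∫⁻ t in Set.Ioc 0 (b ^ r), μ {ω | t < |X ω| ^ r} := by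
  rw [setLIntegral_Ioc_meas_lt (by fun_prop) (by positivity),
    ← lintegral_const_mul' _ _ ENNReal.ofReal_ne_top,
    ← lintegral_const_mul' _ _ ENNReal.ofReal_ne_top]
  refine lintegral_mono fun ω => ?_
  set m := min |X ω| b
  have hm : 0 ≤ m := le_min (abs_nonneg _) hb.le
  have clip_sq : clip b (X ω) ^ 2 = m ^ (2 : ℝ) := by
    rw [← sq_abs, abs_clip hb.le, Real.rpow_two]
  have min_rpow : min (|X ω| ^ r) (b ^ r) = m ^ r :=
    ((Real.monotoneOn_rpow_Ici_of_exponent_nonneg hr0.le).map_min (abs_nonneg (X ω)) hb.le).symm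
  have scaling (q : ℝ) : b ^ (-q) * m ^ q = (m / b) ^ q := by
    rw [Real.div_rpow hm hb.le, Real.rpow_neg hb.le]
    ring
  rw [clip_sq, min_rpow, ← ENNReal.ofReal_mul (by positivity), ← ENNReal.ofReal_mul (by positivity),
    scaling, scaling]
  exact ENNReal.ofReal_le_ofReal <| Real.rpow_le_rpow_of_exponent_ge' (by positivity)
    (div_le_one_of_le₀ (min_le_right _ _) hb.le) hr0.le hr2

theorem rpow_mul_lintegral_sq_centeredSum_clip_le [IsProbabilityMeasure μ] {κ : Type*} [Fintype κ]
    {X : κ → Ω → ℝ} (hX : ∀ k, AEStronglyMeasurable (X k) μ)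
    (h : Pairwise fun j k => NQD μ (X j) (X k)) {b r : ℝ} (hb : 0 < b) (hr0 : 0 < r)
    (hr2 : r ≤ 2) :
    ENNReal.ofReal (b ^ (-2 : ℝ)) *
        ∫⁻ ω, ENNReal.ofReal (centeredSum μ (fun k ω' => clip b (X k ω')) ω ^ 2) ∂μ ≤
      ∑ k, ENNReal.ofReal (b ^ (-r)) *
        ∫⁻ t in Set.Ioc 0 (b ^ r), μ {ω | t < |X k ω| ^ r} := by
  grw [lintegral_sq_centeredSum_clip_le hX h b]
  rw [Finset.mul_sum]
  exact Finset.sum_le_sum fun k _ => rpow_mul_lintegral_sq_clip_le (hX k).aemeasurable hb hr0 hr2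

theorem lintegral_abs_softThreshold_rpow_le {X : Ω → ℝ} (hX : AEMeasurable X μ) {b p : ℝ}
    (hb : 0 ≤ b) (hp : 1 ≤ p) :
    ∫⁻ ω, ENNReal.ofReal (|softThreshold b (X ω)| ^ p) ∂μ ≤
      ∫⁻ t in Set.Ioi (b ^ p), μ {ω | t < |X ω| ^ p} := by
  rw [setLIntegral_Ioi_meas_lt (by fun_prop)]
  refine lintegral_mono fun ω => ?_
  rw [abs_softThreshold hb]
  rcases le_total |X ω| b with hX | hX
  · rw [max_eq_right (sub_nonpos.2 hX), Real.zero_rpow (by linarith), ENNReal.ofReal_zero]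
    exact zero_le
  · rw [max_eq_left (sub_nonneg.2 hX)]
    refine ENNReal.ofReal_le_ofReal (le_sub_iff_add_le.2 ?_)
    simpa only [sub_add_cancel] using Real.add_rpow_le_rpow_add (sub_nonneg.2 hX) hb hp

theorem integrable_of_setLIntegral_Ioi_meas_lt_ne_top [IsFiniteMeasure μ] {X : Ω → ℝ}
    (hX : AEStronglyMeasurable X μ) {b p : ℝ} (hb : 0 ≤ b) (hp : 1 ≤ p)
    (h : ∫⁻ t in Set.Ioi (b ^ p), μ {ω | t < |X ω| ^ p} ≠ ∞) : Integrable X μ := by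
  have memLp_soft : MemLp (fun ω => softThreshold b (X ω)) (ENNReal.ofReal p) μ := by
    refine ⟨(continuous_softThreshold b).comp_aestronglyMeasurable hX, ?_⟩
    rw [eLpNorm_lt_top_iff_lintegral_rpow_enorm_lt_top
      (ENNReal.ofReal_pos.2 (zero_lt_one.trans_le hp)).ne' ENNReal.ofReal_ne_top]
    simp only [Real.enorm_eq_ofReal_abs, ENNReal.toReal_ofReal (zero_le_one.trans hp),
      ENNReal.ofReal_rpow_of_nonneg (abs_nonneg _) (zero_le_one.trans hp)]
    exact (lintegral_abs_softThreshold_rpow_le hX.aemeasurable hb hp).trans_lt h.lt_top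
  exact ((integrable_clip hX b).add (memLp_soft.integrable (ENNReal.one_le_ofReal.2 hp))).congr
    (.of_forall fun ω => clip_add_softThreshold b (X ω))

theorem exists_lintegral_max_abs_centeredSum_rpow_le (μ : Measure Ω) [IsProbabilityMeasure μ]
    {r p ε : ℝ} (hr0 : 0 < r) (hr2 : r ≤ 2) (hp1 : 1 ≤ p) (hp2 : p ≤ 2) (hε : 0 < ε) :
    ∃ C D : ℝ≥0, ∀ {κ : Type u} [Fintype κ] {X : κ → Ω → ℝ} {b : ℝ}, 0 < b →
      (∀ k, Integrable (X k) μ) → Pairwise (fun j k => NQD μ (X j) (X k)) →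
      ∫⁻ ω, ENNReal.ofReal (max (|centeredSum μ X ω| / b - ε) 0 ^ p) ∂μ ≤
        C * (∑ k, ENNReal.ofReal (b ^ (-r)) *
            ∫⁻ t in Set.Ioc 0 (b ^ r), μ {ω | t < |X k ω| ^ r}) +
          D * ∑ k, ENNReal.ofReal (b ^ (-p)) *
            ∫⁻ t in Set.Ioi (b ^ p), μ {ω | t < |X k ω| ^ p} := by
  obtain ⟨K, hK⟩ := exists_lintegral_abs_centeredSum_rpow_le μ hp1 hp2
  refine ⟨(2 ^ p * (ε / 2) ^ (p - 2)).toNNReal, (2 ^ p : ℝ).toNNReal * K,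
    fun {κ _ X b} hb hX h => ?_⟩
  have hclip (k : κ) : AEMeasurable (fun ω => clip b (X k ω)) μ :=
    (integrable_clip (hX k).aestronglyMeasurable b).aemeasurable
  have clipped_le := rpow_mul_lintegral_sq_centeredSum_clip_le
    (fun k => (hX k).aestronglyMeasurable) h hb hr0 hr2
  have excess_le : ENNReal.ofReal (b ^ (-p)) *
      ∫⁻ ω, ENNReal.ofReal (|centeredSum μ (fun k ω' => softThreshold b (X k ω')) ω| ^ p) ∂μ ≤
        K * ∑ k, ENNReal.ofReal (b ^ (-p)) *
          ∫⁻ t in Set.Ioi (b ^ p), μ {ω | t < |X k ω| ^ p} := by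
    grw [hK (fun k => integrable_softThreshold (hX k) b) fun _ _ hjk =>
      (h hjk).comp_monotone (monotone_softThreshold b) (continuous_softThreshold b)
        (monotone_softThreshold b) (continuous_softThreshold b)]
    rw [mul_left_comm, Finset.mul_sum]
    gcongr with k
    exact lintegral_abs_softThreshold_rpow_le (hX k).aemeasurable hb.le hp1
  simp only [centeredSum_eq_clip_add_softThreshold hX b, Pi.add_apply]
  grw [lintegral_max_abs_add_div_sub_rpow_le (aemeasurable_centeredSum hclip) hb hε
    (zero_le_one.trans hp1) hp2, clipped_le, excess_le, ENNReal.coe_mul, mul_assoc]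
  exact le_rfl

theorem mainTheorem11_general {ι : Type*} {κ : ι → Type u} [∀ i, Fintype (κ i)]
    (μ : Measure Ω) [IsProbabilityMeasure μ] {r p : ℝ} (hr0 : 0 < r) (hr2 : r ≤ 2) (hp1 : 1 ≤ p)
    (hp2 : p ≤ 2) {X : (i : ι) → κ i → Ω → ℝ} (hX : ∀ i k, AEStronglyMeasurable (X i k) μ)
    (hnqd : ∀ i, Pairwise fun j k => NQD μ (X i j) (X i k)) {b : ι → ℝ} (hb : ∀ i, 0 < b i)
    (h1 : ∑' i, ∑ k, ENNReal.ofReal (b i ^ (-r)) *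
      ∫⁻ t in Set.Ioc 0 (b i ^ r), μ {ω | t < |X i k ω| ^ r} < ∞)
    (h3 : ∑' i, ∑ k, ENNReal.ofReal (b i ^ (-p)) *
      ∫⁻ t in Set.Ioi (b i ^ p), μ {ω | t < |X i k ω| ^ p} < ∞)
    {ε : ℝ} (hε : 0 < ε) :
    ∑' i, ∫⁻ ω, ENNReal.ofReal (max (|∑ k, (X i k ω - ∫ ω', X i k ω' ∂μ)| / b i - ε) 0 ^ p) ∂μ
      < ∞ := by
  obtain ⟨C, D, row_bound⟩ := exists_lintegral_max_abs_centeredSum_rpow_le μ hr0 hr2 hp1 hp2 hε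
  have integrable (i : ι) (k : κ i) : Integrable (X i k) μ := by
    have row_ne_top := ENNReal.ne_top_of_tsum_ne_top h3.ne i
    have term_ne_top := ENNReal.sum_ne_top.1 row_ne_top k (Finset.mem_univ k)
    refine integrable_of_setLIntegral_Ioi_meas_lt_ne_top (hX i k) (hb i).le hp1 fun h_top => ?_
    rw [h_top, ENNReal.mul_top (by simpa using Real.rpow_pos_of_pos (hb i) _)] at term_ne_top
    exact term_ne_top rfl
  refine (ENNReal.tsum_le_tsum fun i => row_bound (hb i) (integrable i) (hnqd i)).trans_lt ?_
  rw [ENNReal.tsum_add, ENNReal.tsum_mul_left, ENNReal.tsum_mul_left]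
  exact ENNReal.add_lt_top.2
    ⟨ENNReal.mul_lt_top ENNReal.coe_lt_top h1, ENNReal.mul_lt_top ENNReal.coe_lt_top h3⟩

end

theorem mainTheorem11 {Ω : Type*} [MeasurableSpace Ω] (μ : Measure Ω) [IsProbabilityMeasure μ]
    (r p : ℝ) (hr1 : 1 < r) (hr2 : r < 2) (hp1 : 1 ≤ p) (hpr : p < r)
    (X : (n : ℕ+) → Fin n → Ω → ℝ)
    (hmeas : ∀ (n : ℕ+) (k : Fin n), Measurable (X n k))
    (hnqd : RowwisePairwiseNQD μ X)
    (hmom : ∀ (n : ℕ+) (k : Fin n), Integrable (fun ω => |X n k ω| ^ r) μ)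
    (b : ℕ+ → ℝ) (hb : ∀ n, 0 < b n)
    (h1 : ∑' n : ℕ+, ∑ k : Fin n, ENNReal.ofReal (b n ^ (-r)) *
      ∫⁻ t in Set.Ioc 0 (b n ^ r), μ {ω | t < |X n k ω| ^ r} < ∞)
    (h2 : ∑' n : ℕ+, ∑ k : Fin n,
      (∫⁻ ω, ENNReal.ofReal ({ω' | b n < |X n k ω'|}.indicator (fun ω' => |X n k ω'|) ω) ∂μ) /
        ENNReal.ofReal (b n) < ∞)
    (h3 : ∑' n : ℕ+, ∑ k : Fin n, ENNReal.ofReal (b n ^ (-p)) *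
      ∫⁻ t in Set.Ioi (b n ^ p), μ {ω | t < |X n k ω| ^ p} < ∞)
    (ε : ℝ) (hε : 0 < ε) :
    ∑' n : ℕ+, ∫⁻ ω, ENNReal.ofReal
      (max (|∑ k : Fin n, (X n k ω - ∫ ω', X n k ω' ∂μ)| / b n - ε) 0 ^ p) ∂μ < ∞ :=
  mainTheorem11_general μ (zero_lt_one.trans hr1) hr2.le hp1 (hpr.trans hr2).le
    (fun n k => (hmeas n k).aestronglyMeasurable) (fun n j k hjk => hnqd n j k hjk) hb h1 h3 hε
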